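/- For a finite group $G$, let $\hat G$ be the (finite) set of equivalence classes of irreducible unitary representations of $G$, let $1\in\hat G$ be the trivial representation, and let $d_\rho$ be the degree of $\rho\in\hat G$. For $A,B,C\subset G$, let $r_G(A,B,C)$ be the number of three-term progressions $(x,xy,xy^2)$, $x,y\in G$, that lie in $A\times B\times C$. For $f_1,f_2,f_3:G\to\mathbb R$, put $$\Lambda(f_1,f_2,f_3)=\frac1{|G|^2}\sum_{x,y\in G}f_1(x)f_2(xy)f_3(xy^2).$$ There is an absolute constant $K>0$ such that the following two statements hold for every finite group $G$. (i) For all subsets $A,B,C\subset G$, $$\left|r_G(A,B,C)-\frac{|A||B||C|}{|G|}\right|\le K\left(\sum_{1\ne\rho\in\hat G}\frac1{d_\rho}\right)^{1/8}|G|^2 .$$ (ii) For all $f_1,f_2,f_3:G\to\mathbb R$ with $|f_i(x)|\le 1$ for all $x\in G$ and $i=1,2,3$, and with $\sum_{x\in G}f_3(x)=0$, $$|\Lambda(f_1,f_2,f_3)|\le K\left(\sum_{1\ne\rho\in\hat G}\frac1{d_\rho}\right)^{1/8}.$$ -/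

import Mathlib

universe u

noncomputable section

/-- The action of `G` on `ℂⁿ` given by a homomorphism from `G` into the unitary group `U(n)`. -/
def unitaryMatrixRep {G : Type u} [Group G] {n : ℕ} (φ : G →* Matrix.unitaryGroup (Fin n) ℂ) :
    Representation ℂ G (Fin n → ℂ) :=
  (Matrix.toLinAlgEquiv' (R := ℂ) (n := Fin n) :
      Matrix (Fin n) (Fin n) ℂ →* Module.End ℂ (Fin n → ℂ)).comp
    ((Matrix.unitaryGroup (Fin n) ℂ).subtype.comp φ)

/-- An irreducible unitary representation of `G`, in matrix form: a homomorphism into the unitary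
group `U(n)` whose action on `ℂⁿ` is irreducible (in particular `n ≠ 0`). -/
structure IrrUnitaryRep (G : Type u) [Group G] where
  /-- the degree -/
  deg : ℕ
  /-- the homomorphism into the unitary group -/
  hom : G →* Matrix.unitaryGroup (Fin deg) ℂ
  /-- irreducibility of the action on `ℂⁿ` -/
  irr : (unitaryMatrixRep hom).IsIrreducible

namespace IrrUnitaryRep

variable (G : Type u) [Group G]

/-- Irreducible unitary representations are identified when they are equivalent. (For irreducible
unitary representations, an invertible intertwiner can always be rescaled to a unitary one.) -/
instance setoid : Setoid (IrrUnitaryRep G) where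
  r ρ σ := Nonempty ((unitaryMatrixRep ρ.hom).Equiv (unitaryMatrixRep σ.hom))
  iseqv :=
    { refl := fun _ => ⟨Representation.Equiv.refl _⟩
      symm := fun ⟨e⟩ => ⟨e.symm⟩
      trans := fun ⟨e⟩ ⟨f⟩ => ⟨e.trans f⟩ }

/-- The trivial representation, of degree one. -/
def trivial : IrrUnitaryRep G where
  deg := 1
  hom := 1
  irr := by
    have key : ∀ N : Submodule ℂ (Fin 1 → ℂ), N = ⊥ ∨ N = ⊤ := by
      have : IsSimpleModule ℂ (Fin 1 → ℂ) := by
        rw [← LinearEquiv.isSimpleModule_iff (LinearEquiv.funUnique (Fin 1) ℂ ℂ).symm]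
        infer_instance
      exact fun N => IsSimpleOrder.eq_bot_or_eq_top N
    have hne : (⊥ : Submodule ℂ (Fin 1 → ℂ)) ≠ ⊤ := bot_ne_top
    refine { exists_pair_ne := ⟨⊥, ⊤, fun h => hne ?_⟩, eq_bot_or_eq_top := fun N => ?_ }
    · exact congrArg Subrepresentation.toSubmodule h
    · rcases key N.toSubmodule with h | h
      · exact Or.inl (Subrepresentation.toSubmodule_injective h)
      · exact Or.inr (Subrepresentation.toSubmodule_injective h)

end IrrUnitaryRep

/-- The unitary dual `Ĝ` of `G`: the irreducible unitary representations up to equivalence. -/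
def UnitaryDual (G : Type u) [Group G] : Type u :=
  Quotient (IrrUnitaryRep.setoid G)

namespace UnitaryDual

variable {G : Type u} [Group G]

/-- The degree `d_ρ` of `ρ ∈ Ĝ`. -/
def deg (ρ : UnitaryDual G) : ℕ :=
  Quotient.lift IrrUnitaryRep.deg
    (fun ρ σ h => by
      obtain ⟨e⟩ : Nonempty ((unitaryMatrixRep ρ.hom).Equiv (unitaryMatrixRep σ.hom)) := h
      simpa using e.toLinearEquiv.finrank_eq) ρ

/-- The class of the trivial representation. -/
def trivial (G : Type u) [Group G] : UnitaryDual G :=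
  Quotient.mk _ (IrrUnitaryRep.trivial G)

/-- A finite group has only finitely many irreducible unitary representations up to equivalence,
so that sums over `Ĝ` make sense. -/
instance finite (G : Type u) [Group G] [Finite G] : Finite (UnitaryDual G) := by
  classical
  have := Fintype.ofFinite G
  have hc : (Nat.card G : ℂ) ≠ 0 := by simp
  have := invertibleOfNonzero hc
  let χ : UnitaryDual G → G → ℂ := fun ρ =>
    (unitaryMatrixRep (Quotient.out ρ).hom).character
  have orth : ∀ ρ σ : UnitaryDual G,
      (Nat.card G : ℂ)⁻¹ * ∑ g : G, χ ρ g * χ σ g⁻¹ = if ρ = σ then 1 else 0 := by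
    intro ρ σ
    have := ρ.out.irr
    have := σ.out.irr
    have h := Representation.char_orthonormal (unitaryMatrixRep ρ.out.hom)
      (unitaryMatrixRep σ.out.hom)
    refine h.trans ?_
    congr 1
    refine propext ⟨fun h => ?_, fun h => ?_⟩
    · rw [← Quotient.out_eq ρ, ← Quotient.out_eq σ]
      exact (Quotient.sound h).symm
    · subst h
      exact ⟨Representation.Equiv.refl _⟩
  have li : LinearIndependent ℂ χ := by
    rw [linearIndependent_iff']
    intro s c hs σ hσ
    have h1 : ∀ g, ∑ ρ ∈ s, c ρ * χ ρ g = 0 := fun g => by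
      simpa using congrFun hs g
    have h2 : ∑ ρ ∈ s, c ρ * ((Nat.card G : ℂ)⁻¹ * ∑ g : G, χ ρ g * χ σ g⁻¹) = 0 := by
      calc ∑ ρ ∈ s, c ρ * ((Nat.card G : ℂ)⁻¹ * ∑ g : G, χ ρ g * χ σ g⁻¹)
          = (Nat.card G : ℂ)⁻¹ * ∑ g : G, (∑ ρ ∈ s, c ρ * χ ρ g) * χ σ g⁻¹ := by
            simp only [Finset.mul_sum, Finset.sum_mul]
            rw [Finset.sum_comm]
            refine Finset.sum_congr rfl fun g _ => Finset.sum_congr rfl fun ρ _ => by ring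
        _ = 0 := by simp [h1]
    simp only [orth] at h2
    simpa [hσ] using h2
  exact li.finite

instance fintype (G : Type u) [Group G] [Finite G] : Fintype (UnitaryDual G) :=
  Fintype.ofFinite _

end UnitaryDual

open Classical in
/-- The sum `∑ 1 / d_ρ` over the nontrivial `ρ ∈ Ĝ`. -/
def sumInvDeg (G : Type u) [Group G] [Finite G] : ℝ :=
  ∑ ρ : UnitaryDual G with ρ ≠ UnitaryDual.trivial G, 1 / (ρ.deg : ℝ)

/-- `r_G(A, B, C)`: the number of three-term progressions `(x, xy, xy²)` in `A × B × C`. -/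
def progressionCount {G : Type u} [Group G] (A B C : Finset G) : ℕ :=
  {p : G × G × G | p.1 ∈ A ∧ p.2.1 ∈ B ∧ p.2.2 ∈ C ∧ ∃ x y : G, p = (x, x * y, x * y ^ 2)}.ncard

/-- The mean `𝔼_x f(x)` of a function on a finite group. -/
def groupMean {G : Type u} [Fintype G] (f : G → ℝ) : ℝ :=
  (∑ x, f x) / Fintype.card G

/-- `Λ(f₁, f₂, f₃) = 𝔼_{x,y} f₁(x) f₂(xy) f₃(xy²)`. -/
def progressionForm {G : Type u} [Group G] [Fintype G] (f₁ f₂ f₃ : G → ℝ) : ℝ :=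
  groupMean fun x => groupMean fun y => f₁ x * f₂ (x * y) * f₃ (x * y ^ 2)

end

/-! Write `N = |G|`, `S = ∑ 1/d_ρ` over nontrivial `ρ`, and `f = f₃`. Two applications of
Cauchy–Schwarz remove `f₂` and then `f₁`. The square sum that remains involves only `f`, and a
change of variables turns it into correlations `∑_v F(v) H(v · y⁻¹zy)` summed over `y`, with `F(v) =
f(v) f(vh)` and `H(u) = f(uz) f(uhz)`.

Summing over `y` makes such a correlation a class function of `z`, so it expands in irreducible
characters. The trivial character contributes the product `(∑ F)(∑ H)`. A nontrivial `ρ` contributes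
little because convolution with its character has `L¹` size at most `N²/d_ρ` on functions bounded by
1 (`deg_mul_sum_norm_conv_char_le`). This is the mixing estimate `abs_sum_conj_correlation_sub_le`.

The estimate is used twice in `sum_sq_sum_le`: once to replace each correlation by `(∑ F)(∑ H)`, and
once, with `∑ f = 0`, to show that `∑ H` summed over `z` is small for most `h`. Hence the fourth
power of the unnormalised form is at most `2 N⁸ S`. The counting statement follows by centring the
indicator of `C`.

The character theory rests on Schur's lemma and on completeness of the unitary characters among
class functions. -/

open scoped ComplexConjugate

/-! ### Schur's lemma for class functions -/

section Schur

variable {G V W : Type*} [Group G] [AddCommGroup V] [Module ℂ V] [AddCommGroup W] [Module ℂ W]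

/-- Irreducibility is invariant under equivalence of representations. -/
theorem Representation.IsIrreducible.of_equiv {σ : Representation ℂ G V} {τ : Representation ℂ G W}
    (e : σ.Equiv τ) (h : τ.IsIrreducible) : σ.IsIrreducible := by
  rw [Representation.irreducible_iff_isSimpleModule_asModule] at h ⊢
  have hb : Function.Bijective
      (Representation.IntertwiningMap.equivLinearMapAsModule σ τ e.toIntertwiningMap) :=
    e.toLinearEquiv.bijective
  exact IsSimpleModule.congr (LinearEquiv.ofBijective _ hb)

/-- Schur's lemma for the operator attached to a class function. -/
theorem Representation.sum_classFunction_smul [Fintype G] [FiniteDimensional ℂ V]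
    (σ : Representation ℂ G V) [hσ : σ.IsIrreducible] (φ : G → ℂ)
    (hφ : ∀ g h, φ (h * g * h⁻¹) = φ g) :
    (Module.finrank ℂ V : ℂ) • ∑ g, φ g • σ g
      = (∑ g, φ g * σ.character g) • (1 : V →ₗ[ℂ] V) := by
  -- Conjugation invariance of `φ` makes this operator commute with `σ`, so it is a scalar, which
  -- the trace determines.
  let T : Representation.IntertwiningMap σ σ :=
    { toLinearMap := ∑ g, φ g • σ g
      isIntertwining' := fun h => by
        rw [← Module.End.mul_eq_comp, ← Module.End.mul_eq_comp, Finset.sum_mul, Finset.mul_sum]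
        refine Fintype.sum_equiv (MulAut.conj h⁻¹).toEquiv _ _ fun g => ?_
        have h1 : φ (h⁻¹ * g * h⁻¹⁻¹) = φ g := hφ g h⁻¹
        simp only [MulEquiv.toEquiv_eq_coe, EquivLike.coe_coe, MulAut.conj_apply, h1,
          smul_mul_assoc, mul_smul_comm, ← map_mul]
        congr 2
        group }
  obtain ⟨c, hc⟩ :=
    (Representation.IsIrreducible.algebraMap_intertwiningMap_bijective_of_isAlgClosed :
      Function.Bijective (algebraMap ℂ (Representation.IntertwiningMap σ σ))).2 T
  have hT : ∑ g, φ g • σ g = c • (1 : V →ₗ[ℂ] V) := by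
    have := congrArg Representation.IntertwiningMap.toLinearMap hc
    rw [Representation.IntertwiningMap.algebraMap_apply] at this
    exact this.symm
  have htr : ∑ g, φ g * σ.character g = c * Module.finrank ℂ V := by
    have := congrArg (LinearMap.trace ℂ V) hT
    simpa [Representation.character] using this
  rw [htr, hT, smul_smul, mul_comm]

end Schur

/-! ### Unitary matrix forms and irreducible subrepresentations -/

section Unitarize

open scoped InnerProductSpace

variable {G : Type u} {V : Type*} [Group G] [NormedAddCommGroup V] [InnerProductSpace ℂ V]
  [FiniteDimensional ℂ V]

/-- An irreducible representation by isometries is equivalent to one in unitary matrix form. -/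
theorem IrrUnitaryRep.exists_equiv (σ : Representation ℂ G V) (hσ : σ.IsIrreducible)
    (hiso : ∀ g v w, ⟪σ g v, σ g w⟫_ℂ = ⟪v, w⟫_ℂ) :
    ∃ ρ : IrrUnitaryRep G, Nonempty ((unitaryMatrixRep ρ.hom).Equiv σ) := by
  let b := stdOrthonormalBasis ℂ V
  let m : G →* Matrix (Fin (Module.finrank ℂ V)) (Fin (Module.finrank ℂ V)) ℂ :=
    ((LinearMap.toMatrixOrthonormal b : _ →* _)).comp σ
  have hm : ∀ g, m g = LinearMap.toMatrix b.toBasis b.toBasis (σ g) := fun g => rfl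
  have hu : ∀ g, m g ∈ Matrix.unitaryGroup (Fin (Module.finrank ℂ V)) ℂ := by
    intro g
    rw [Matrix.mem_unitaryGroup_iff']
    have hadj : star (σ g) * σ g = 1 := by
      refine LinearMap.ext fun v => ext_inner_right ℂ fun w => ?_
      rw [LinearMap.star_eq_adjoint, Module.End.mul_apply, LinearMap.adjoint_inner_left, hiso]
      rfl
    change star (LinearMap.toMatrixOrthonormal b (σ g)) * LinearMap.toMatrixOrthonormal b (σ g) = 1
    rw [← map_star, ← map_mul, hadj, map_one]
  let φ : G →* Matrix.unitaryGroup (Fin (Module.finrank ℂ V)) ℂ := m.codRestrict _ hu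
  have e : (unitaryMatrixRep φ).Equiv σ := by
    refine (Representation.Equiv.mk b.toBasis.equivFun fun g => ?_).symm
    refine LinearMap.ext fun v => ?_
    change b.toBasis.repr (σ g v) = Matrix.mulVec (m g) (b.toBasis.repr v)
    rw [hm, LinearMap.toMatrix_mulVec_repr]
  exact ⟨⟨_, φ, hσ.of_equiv e⟩, ⟨e⟩⟩

/-- Below a nonzero subrepresentation there is an irreducible one. -/
theorem Subrepresentation.exists_irreducible_le {W : Type*} [AddCommGroup W] [Module ℂ W]
    [FiniteDimensional ℂ W] {σ : Representation ℂ G W} (U : Subrepresentation σ) (hU : U ≠ ⊥) :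
    ∃ A : Subrepresentation σ, A ≠ ⊥ ∧ A ≤ U ∧ A.toRepresentation.IsIrreducible := by
  have hmono : StrictMono (Subrepresentation.toSubmodule : Subrepresentation σ → Submodule ℂ W) :=
    fun A B h => lt_of_le_of_ne h.le fun h' => h.ne (Subrepresentation.toSubmodule_injective h')
  have : WellFoundedLT (Subrepresentation σ) := hmono.wellFoundedLT
  obtain h | ⟨A, hA, hAU⟩ := (isAtomic_of_orderBot_wellFounded_lt
    (wellFounded_lt (α := Subrepresentation σ))).eq_bot_or_exists_atom_le U
  · exact absurd h hU
  refine ⟨A, hA.1, hAU, ?_⟩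
  -- Pushing subrepresentations of `A` into `σ` lets the minimality of the atom `A` give its
  -- irreducibility.
  let lift : Subrepresentation A.toRepresentation → Subrepresentation σ := fun B =>
    { toSubmodule := B.toSubmodule.map A.toSubmodule.subtype
      apply_mem_toSubmodule := by
        rintro g _ ⟨v, hv, rfl⟩
        exact ⟨_, B.apply_mem_toSubmodule g hv, rfl⟩ }
  have lift_inj : ∀ B C, lift B = lift C → B = C := fun B C h =>
    Subrepresentation.toSubmodule_injective
      (Submodule.map_injective_of_injective A.toSubmodule.injective_subtype
        (congrArg Subrepresentation.toSubmodule h))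
  have lift_bot : lift ⊥ = ⊥ := Subrepresentation.toSubmodule_injective (Submodule.map_bot _)
  have lift_top : lift ⊤ = A :=
    Subrepresentation.toSubmodule_injective (Submodule.map_subtype_top _)
  have lift_le : ∀ B, lift B ≤ A := fun B => Submodule.map_subtype_le A.toSubmodule B.toSubmodule
  refine { exists_pair_ne := ⟨⊥, ⊤, fun h => hA.1 ?_⟩, eq_bot_or_eq_top := fun B => ?_ }
  · rw [← lift_top, ← h, lift_bot]
  · rcases hA.le_iff.1 (lift_le B) with h | h
    · exact Or.inl (lift_inj _ _ (h.trans lift_bot.symm))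
    · exact Or.inr (lift_inj _ _ (h.trans lift_top.symm))

end Unitarize

/-! ### The regular representation -/

section Regular

open scoped InnerProductSpace

variable (G : Type u) [Group G] [Fintype G]

/-- The left regular representation on `ℓ²(G)`. -/
noncomputable def euclideanRegularRep : Representation ℂ G (EuclideanSpace ℂ G) where
  toFun g := (LinearIsometryEquiv.piLpCongrLeft 2 ℂ ℂ (Equiv.mulLeft g)).toLinearEquiv.toLinearMap
  map_one' := by
    ext f x
    exact congrArg f (show (1 : G)⁻¹ * x = x by simp)
  map_mul' g h := by
    ext f x
    exact congrArg f (show (g * h)⁻¹ * x = h⁻¹ * (g⁻¹ * x) by group)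

variable {G}

theorem euclideanRegularRep_apply (g : G) (f : EuclideanSpace ℂ G) (x : G) :
    euclideanRegularRep G g f x = f (g⁻¹ * x) := rfl

theorem inner_euclideanRegularRep (g : G) (f f' : EuclideanSpace ℂ G) :
    ⟪euclideanRegularRep G g f, euclideanRegularRep G g f'⟫_ℂ = ⟪f, f'⟫_ℂ :=
  (LinearIsometryEquiv.piLpCongrLeft 2 ℂ ℂ (Equiv.mulLeft g)).inner_map_map f f'

theorem inner_euclideanRegularRep_right (g : G) (f f' : EuclideanSpace ℂ G) :
    ⟪f, euclideanRegularRep G g f'⟫_ℂ = ⟪euclideanRegularRep G g⁻¹ f, f'⟫_ℂ := by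
  rw [← inner_euclideanRegularRep g⁻¹ f, ← Module.End.mul_apply, ← map_mul]
  simp

end Regular

/-! ### Orthogonality and completeness of characters -/

section Characters

open scoped InnerProductSpace

variable {G : Type u} [Group G]

namespace IrrUnitaryRep

/-- The character of an irreducible unitary representation. -/
noncomputable def char (ρ : IrrUnitaryRep G) : G → ℂ := (unitaryMatrixRep ρ.hom).character

theorem char_eq_trace (ρ : IrrUnitaryRep G) (g : G) :
    ρ.char g = (ρ.hom g : Matrix (Fin ρ.deg) (Fin ρ.deg) ℂ).trace :=
  Matrix.trace_toLin'_eq _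

theorem char_inv (ρ : IrrUnitaryRep G) (g : G) : ρ.char g⁻¹ = conj (ρ.char g) := by
  rw [char_eq_trace, char_eq_trace, map_inv, starRingEnd_apply, ← Matrix.trace_conjTranspose]
  rfl

theorem char_conj (ρ : IrrUnitaryRep G) (g h : G) : ρ.char (h * g * h⁻¹) = ρ.char g :=
  Representation.char_conj _ g h

theorem deg_ne_zero (ρ : IrrUnitaryRep G) : ρ.deg ≠ 0 := by
  intro h
  have := ρ.irr
  obtain ⟨A, B, hAB⟩ := exists_pair_ne (Subrepresentation (unitaryMatrixRep ρ.hom))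
  have : IsEmpty (Fin ρ.deg) := by rw [h]; infer_instance
  exact hAB (Subrepresentation.toSubmodule_injective (Subsingleton.elim _ _))

theorem sum_char_inv_mul_char [Fintype G] (ρ : IrrUnitaryRep G) :
    ∑ u, ρ.char u⁻¹ * ρ.char u = Fintype.card G := by
  have := ρ.irr
  have hc : (Nat.card G : ℂ) ≠ 0 := by simp
  have := invertibleOfNonzero hc
  have h := Representation.char_orthonormal (unitaryMatrixRep ρ.hom) (unitaryMatrixRep ρ.hom)
  rw [if_pos ⟨Representation.Equiv.refl _⟩, inv_mul_eq_iff_eq_mul₀ hc, mul_one] at h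
  rw [← Nat.card_eq_fintype_card, ← h]
  exact Finset.sum_congr rfl fun u _ => mul_comm _ _

/-- Characters are, up to a scalar, idempotents for convolution. -/
theorem deg_mul_sum_char_mul_char [Fintype G] (ρ : IrrUnitaryRep G) (w : G) :
    (ρ.deg : ℂ) * ∑ u, ρ.char u⁻¹ * ρ.char (u * w) = Fintype.card G * ρ.char w := by
  have := ρ.irr
  have h := (unitaryMatrixRep ρ.hom).sum_classFunction_smul (fun u => ρ.char u⁻¹) fun g h => by
    rw [mul_inv_rev, mul_inv_rev, inv_inv, ← mul_assoc, char_conj]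
  have hs : ∑ u, ρ.char u⁻¹ * (unitaryMatrixRep ρ.hom).character u = Fintype.card G :=
    ρ.sum_char_inv_mul_char
  rw [hs, Module.finrank_fin_fun] at h
  -- Multiplying the scalar identity for `∑ χ(u⁻¹) σ(u)` by `σ(w)` and taking traces gives the
  -- convolution.
  have h2 := congrArg (fun T => LinearMap.trace ℂ _ (T * unitaryMatrixRep ρ.hom w)) h
  simpa [char, Representation.character, Finset.sum_mul, smul_mul_assoc] using h2

/-- A class function orthogonal to all irreducible unitary characters vanishes. -/
theorem eq_zero_of_sum_mul_char_eq_zero [Fintype G] (φ : G → ℂ)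
    (hφ : ∀ g h, φ (h * g * h⁻¹) = φ g) (h0 : ∀ ρ : IrrUnitaryRep G, ∑ g, φ g * ρ.char g = 0) :
    φ = 0 := by
  classical
  let T : EuclideanSpace ℂ G →ₗ[ℂ] EuclideanSpace ℂ G := ∑ g, φ g • euclideanRegularRep G g
  have hT : ∀ v, T v = ∑ g, φ g • euclideanRegularRep G g v := fun v => by simp [T]
  have hcomm : ∀ h v, T (euclideanRegularRep G h v) = euclideanRegularRep G h (T v) := by
    intro h v
    rw [hT, hT, map_sum]
    refine Fintype.sum_equiv (MulAut.conj h⁻¹).toEquiv _ _ fun g => ?_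
    have h1 : φ (h⁻¹ * g * h⁻¹⁻¹) = φ g := hφ g h⁻¹
    simp only [MulEquiv.toEquiv_eq_coe, EquivLike.coe_coe, MulAut.conj_apply, h1, map_smul,
      ← Module.End.mul_apply, ← map_mul]
    congr 3
    group
  -- If `T ≠ 0`, this complement contains an irreducible `A`. By Schur and `h0`, `T` kills `A`, so
  -- `A` lies in both `ker T` and its orthogonal complement.
  let U : Subrepresentation (euclideanRegularRep G) :=
    { toSubmodule := (LinearMap.ker T)ᗮ
      apply_mem_toSubmodule := fun g v hv => by
        rw [Submodule.mem_orthogonal] at hv ⊢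
        intro k hk
        rw [inner_euclideanRegularRep_right]
        refine hv _ ?_
        rw [LinearMap.mem_ker] at hk ⊢
        rw [hcomm, hk, map_zero] }
  have hU : U = ⊥ := by
    by_contra hU
    obtain ⟨A, hA, hAU, hirr⟩ := U.exists_irreducible_le hU
    have hiso : ∀ g (v w : A.toSubmodule), ⟪A.toRepresentation g v, A.toRepresentation g w⟫_ℂ
        = ⟪v, w⟫_ℂ := fun g v w =>
      inner_euclideanRegularRep g (v : EuclideanSpace ℂ G) (w : EuclideanSpace ℂ G)
    obtain ⟨ρ, ⟨e⟩⟩ := IrrUnitaryRep.exists_equiv (V := A.toSubmodule) A.toRepresentation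
      hirr hiso
    have hs := Representation.sum_classFunction_smul A.toRepresentation (hσ := hirr) φ hφ
    have hchar : A.toRepresentation.character = ρ.char := (Representation.char_iso e).symm
    rw [hchar, h0 ρ, zero_smul, smul_eq_zero] at hs
    refine hA (Subrepresentation.toSubmodule_injective ((Submodule.eq_bot_iff _).2 fun v hv => ?_))
    have hker : T v = 0 := by
      rcases hs with hs | hs
      · have : Module.finrank ℂ A.toSubmodule = 0 := by exact_mod_cast hs
        rw [Submodule.finrank_eq_zero] at this
        rw [this, Submodule.mem_bot] at hv
        rw [hv, map_zero]
      · have := congrArg Subtype.val (LinearMap.congr_fun hs ⟨v, hv⟩)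
        rw [hT]
        simpa [Subrepresentation.toRepresentation] using this
    have horth : v ∈ (LinearMap.ker T)ᗮ := hAU hv
    exact inner_self_eq_zero.1 ((Submodule.mem_orthogonal _ _).1 horth v hker)
  have hker : LinearMap.ker T = ⊤ :=
    (Submodule.orthogonal_eq_bot_iff).1 (congrArg Subrepresentation.toSubmodule hU)
  funext x
  -- Applied to the point mass at 1, `T` returns `φ` itself.
  have hx : T (EuclideanSpace.single 1 1) x = 0 := by
    rw [LinearMap.ker_eq_top.1 hker]
    rfl
  rw [hT] at hx
  simpa [euclideanRegularRep_apply, inv_mul_eq_one] using hx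

end IrrUnitaryRep

namespace UnitaryDual

/-- The character of a class of irreducible unitary representations. -/
noncomputable def char (ρ : UnitaryDual G) : G → ℂ := (Quotient.out ρ).char

theorem char_mk (σ : IrrUnitaryRep G) :
    char (Quotient.mk (IrrUnitaryRep.setoid G) σ) = σ.char := by
  obtain ⟨e⟩ : Nonempty ((unitaryMatrixRep (Quotient.out
      (Quotient.mk (IrrUnitaryRep.setoid G) σ)).hom).Equiv (unitaryMatrixRep σ.hom)) :=
    Quotient.exact (Quotient.out_eq (Quotient.mk (IrrUnitaryRep.setoid G) σ))
  exact Representation.char_iso e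

theorem deg_out (ρ : UnitaryDual G) : (Quotient.out ρ).deg = ρ.deg := by
  conv_rhs => rw [← Quotient.out_eq ρ]
  rfl

theorem char_trivial (g : G) : (trivial G).char g = 1 := by
  rw [trivial, char_mk, IrrUnitaryRep.char_eq_trace]
  exact (Matrix.trace_one).trans (by simp [show (IrrUnitaryRep.trivial G).deg = 1 from rfl])

theorem sum_char_mul_char_inv [Fintype G] (ρ σ : UnitaryDual G) [Decidable (ρ = σ)] :
    ∑ g, ρ.char g * σ.char g⁻¹ = if ρ = σ then (Fintype.card G : ℂ) else 0 := by
  have := ρ.out.irr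
  have := σ.out.irr
  have hc : (Nat.card G : ℂ) ≠ 0 := by simp
  have := invertibleOfNonzero hc
  split_ifs with heq
  · subst heq
    rw [← ρ.out.sum_char_inv_mul_char]
    exact Finset.sum_congr rfl fun u _ => mul_comm _ _
  · have h := Representation.char_orthonormal (unitaryMatrixRep ρ.out.hom)
      (unitaryMatrixRep σ.out.hom)
    rw [if_neg, inv_mul_eq_iff_eq_mul₀ hc, mul_zero] at h
    · exact h
    · intro h'
      rw [← Quotient.out_eq ρ, ← Quotient.out_eq σ] at heq
      exact heq (Quotient.sound h').symm

/-- Expansion of a class function in irreducible characters. -/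
theorem card_mul_eq_sum_char [Fintype G] (φ : G → ℂ) (hφ : ∀ g h, φ (h * g * h⁻¹) = φ g) (t : G) :
    (Fintype.card G : ℂ) * φ t = ∑ ρ : UnitaryDual G, (∑ g, φ g * ρ.char g⁻¹) * ρ.char t := by
  classical
  -- The argument is inverted because the vanishing criterion pairs with `χ(g)`, while the
  -- coefficients pair with `χ(g⁻¹)`.
  let ψ : G → ℂ := fun g =>
    Fintype.card G * φ g⁻¹ - ∑ ρ : UnitaryDual G, (∑ g, φ g * ρ.char g⁻¹) * ρ.char g⁻¹
  have hψ : ψ = 0 := by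
    refine IrrUnitaryRep.eq_zero_of_sum_mul_char_eq_zero ψ (fun g h => ?_) fun σ => ?_
    · have hinv : (h * g * h⁻¹)⁻¹ = h * g⁻¹ * h⁻¹ := by group
      simp only [ψ, hinv, hφ, char, IrrUnitaryRep.char_conj]
    · rw [← char_mk, ← Equiv.sum_comp (Equiv.inv G)]
      set τ : UnitaryDual G := Quotient.mk (IrrUnitaryRep.setoid G) σ
      have hsum : ∀ c : UnitaryDual G → ℂ,
          ∑ g, (∑ ρ, c ρ * ρ.char g) * τ.char g⁻¹ = c τ * Fintype.card G := fun c => by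
        simp only [Finset.sum_mul]
        rw [Finset.sum_comm]
        simp only [mul_assoc, ← Finset.mul_sum, sum_char_mul_char_inv]
        simp
      simp only [ψ, Equiv.inv_apply, inv_inv, sub_mul, Finset.sum_sub_distrib, hsum]
      simp only [mul_assoc, ← Finset.mul_sum]
      rw [mul_comm, sub_self]
  have := congrFun hψ t⁻¹
  simpa [ψ, sub_eq_zero] using this

theorem char_inv (ρ : UnitaryDual G) (g : G) : ρ.char g⁻¹ = conj (ρ.char g) :=
  ρ.out.char_inv g

theorem char_conj (ρ : UnitaryDual G) (g h : G) : ρ.char (h * g * h⁻¹) = ρ.char g :=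
  ρ.out.char_conj g h

theorem deg_pos (ρ : UnitaryDual G) : 0 < ρ.deg :=
  Nat.pos_of_ne_zero (ρ.deg_out ▸ ρ.out.deg_ne_zero)

theorem deg_mul_sum_char_mul_char [Fintype G] (ρ : UnitaryDual G) (w : G) :
    (ρ.deg : ℂ) * ∑ u, ρ.char u⁻¹ * ρ.char (u * w) = Fintype.card G * ρ.char w := by
  rw [← deg_out]
  exact ρ.out.deg_mul_sum_char_mul_char w

end UnitaryDual

end Characters

/-! ### Mixing estimates from character degrees -/

namespace UnitaryDual

variable {G : Type u} [Group G] [Fintype G]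

theorem sum_norm_char_sq (ρ : UnitaryDual G) : ∑ g, ‖ρ.char g‖ ^ 2 = Fintype.card G := by
  classical
  have h := sum_char_mul_char_inv ρ ρ
  simp only [char_inv, Complex.mul_conj', if_true] at h
  exact_mod_cast h

theorem sum_norm_char_le (ρ : UnitaryDual G) : ∑ g, ‖ρ.char g‖ ≤ Fintype.card G := by
  have h := Finset.sum_mul_sq_le_sq_mul_sq Finset.univ (fun _ => (1 : ℝ)) fun g => ‖ρ.char g‖
  simp only [one_mul, one_pow, Finset.sum_const, Finset.card_univ, nsmul_eq_mul, mul_one,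
    sum_norm_char_sq] at h
  nlinarith [Nat.cast_nonneg (α := ℝ) (Fintype.card G),
    Finset.sum_nonneg fun g (_ : g ∈ Finset.univ) => norm_nonneg (ρ.char g)]

theorem deg_mul_sum_char_left_mul_char (ρ : UnitaryDual G) (a b : G) :
    (ρ.deg : ℂ) * ∑ w, ρ.char (a⁻¹ * w) * ρ.char (w⁻¹ * b)
      = Fintype.card G * ρ.char (a⁻¹ * b) := by
  rw [← deg_mul_sum_char_mul_char]
  congr 1
  refine Fintype.sum_equiv ((Equiv.inv G).trans (Equiv.mulRight a)) _ _ fun w => ?_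
  simp [mul_assoc]

/-- Convolution with an irreducible character maps bounded functions to functions of small mean. -/
theorem deg_mul_sum_norm_conv_char_le (ρ : UnitaryDual G) (H : G → ℝ) (hH : ∀ x, |H x| ≤ 1) :
    ρ.deg * ∑ w, ‖∑ u, (H u : ℂ) * ρ.char (u⁻¹ * w)‖ ≤ (Fintype.card G : ℝ) ^ 2 := by
  set S : G → ℂ := fun w => ∑ u, (H u : ℂ) * ρ.char (u⁻¹ * w) with hS
  have hconj : ∀ w, conj (S w) = ∑ u, (H u : ℂ) * ρ.char (w⁻¹ * u) := fun w => by
    simp [hS, map_sum, ← char_inv]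
  -- As `χ ∗ χ = (N/d) χ`, convolution with `χ` is a multiple of a projection, so the square norm of
  -- `S` reduces to its pairing with `H`.
  have hsq : (ρ.deg : ℂ) * ∑ w, (‖S w‖ : ℂ) ^ 2 = Fintype.card G * ∑ v, (H v : ℂ) * S v := by
    calc (ρ.deg : ℂ) * ∑ w, (‖S w‖ : ℂ) ^ 2
        = ρ.deg * ∑ w, ∑ u, ∑ v, ((H u : ℂ) * ρ.char (u⁻¹ * w)) * (H v * ρ.char (w⁻¹ * v)) := by
          congr 1
          refine Finset.sum_congr rfl fun w _ => ?_
          rw [← Complex.mul_conj', hconj, hS, Finset.sum_mul_sum]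
      _ = ∑ v, ∑ u, (H v : ℂ) * H u *
            (ρ.deg * ∑ w, ρ.char (u⁻¹ * w) * ρ.char (w⁻¹ * v)) := by
          simp only [Finset.mul_sum]
          refine (Finset.sum_congr rfl fun w _ => Finset.sum_comm).trans ?_
          rw [Finset.sum_comm]
          refine Finset.sum_congr rfl fun v _ => ?_
          rw [Finset.sum_comm]
          refine Finset.sum_congr rfl fun u _ => Finset.sum_congr rfl fun w _ => ?_
          ring
      _ = Fintype.card G * ∑ v, (H v : ℂ) * S v := by
          simp only [deg_mul_sum_char_left_mul_char]
          simp only [hS, Finset.mul_sum]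
          refine Finset.sum_congr rfl fun v _ => Finset.sum_congr rfl fun u _ => ?_
          ring
  set a := ∑ w, ‖S w‖
  set N : ℝ := (Fintype.card G : ℝ) with hN
  have hN0 : 0 < N := by simp [hN, Fintype.card_pos]
  have hd0 : (0 : ℝ) < ρ.deg := by exact_mod_cast ρ.deg_pos
  have ha0 : 0 ≤ a := Finset.sum_nonneg fun _ _ => norm_nonneg _
  have hle : ρ.deg * ∑ w, ‖S w‖ ^ 2 ≤ N * a := by
    have h1 : ‖(ρ.deg : ℂ) * ∑ w, (‖S w‖ : ℂ) ^ 2‖ = ρ.deg * ∑ w, ‖S w‖ ^ 2 := by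
      have : (ρ.deg : ℂ) * ∑ w, (‖S w‖ : ℂ) ^ 2 = ((ρ.deg * ∑ w, ‖S w‖ ^ 2 : ℝ) : ℂ) := by
        push_cast; rfl
      rw [this, Complex.norm_real, Real.norm_of_nonneg]
      positivity
    rw [← h1, hsq, norm_mul, Complex.norm_natCast]
    refine mul_le_mul_of_nonneg_left ((norm_sum_le _ _).trans (Finset.sum_le_sum fun v _ => ?_))
      hN0.le
    rw [norm_mul, Complex.norm_real, Real.norm_eq_abs]
    exact mul_le_of_le_one_left (norm_nonneg _) (hH v)
  have hcs : a ^ 2 ≤ N * ∑ w, ‖S w‖ ^ 2 := by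
    have h := Finset.sum_mul_sq_le_sq_mul_sq Finset.univ (fun _ => (1 : ℝ)) fun g => ‖S g‖
    simpa only [one_mul, one_pow, Finset.sum_const, Finset.card_univ, nsmul_eq_mul, mul_one] using h
  -- The `L²` norm is eliminated: `d a² ≤ d N ‖S‖₂² ≤ N² a`.
  have hfin : (ρ.deg * a) * a ≤ N ^ 2 * a := by
    nlinarith [mul_le_mul_of_nonneg_left hcs hd0.le, mul_le_mul_of_nonneg_left hle hN0.le]
  rcases ha0.eq_or_lt with h0 | h0
  · rw [← h0, mul_zero]
    positivity
  · exact le_of_mul_le_mul_right hfin h0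

/-- Averaging a correlation over a conjugacy class: the deviation from the product of the sums is
controlled by the nontrivial characters. -/
theorem abs_sum_conj_correlation_sub_le [DecidableEq (UnitaryDual G)] (F H : G → ℝ)
    (hF : ∀ x, |F x| ≤ 1) (hH : ∀ x, |H x| ≤ 1) (t : G) :
    |∑ y, ∑ w, F w * H (w * (y⁻¹ * t * y)) - (∑ w, F w) * ∑ w, H w|
      ≤ (Fintype.card G : ℝ) ^ 2 *
        ∑ ρ : UnitaryDual G with ρ ≠ trivial G, ‖ρ.char t‖ / ρ.deg := by
  set N : ℝ := (Fintype.card G : ℝ) with hN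
  have hN0 : 0 < N := by simp [hN, Fintype.card_pos]
  set Φ : G → ℂ := fun t => ∑ y, ∑ w, (F w : ℂ) * H (w * (y⁻¹ * t * y)) with hΦ
  have hclass : ∀ g h, Φ (h * g * h⁻¹) = Φ g := fun g h => by
    refine Fintype.sum_equiv (Equiv.mulLeft h⁻¹) _ _ fun y => ?_
    simp [mul_assoc]
  set c : UnitaryDual G → ℂ := fun ρ => ∑ g, Φ g * ρ.char g⁻¹ with hc
  -- Substituting `u = w y⁻¹ g y` makes `u⁻¹w` a conjugate of `g⁻¹`, so every `y` contributes the
  -- same amount.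
  have hcoef : ∀ ρ, c ρ = Fintype.card G * ∑ w, (F w : ℂ) * ∑ u, (H u : ℂ) * ρ.char (u⁻¹ * w) := by
    intro ρ
    have hy : ∀ y, ∑ g, (∑ w, (F w : ℂ) * H (w * (y⁻¹ * g * y))) * ρ.char g⁻¹
        = ∑ w, (F w : ℂ) * ∑ u, (H u : ℂ) * ρ.char (u⁻¹ * w) := fun y => by
      simp only [Finset.sum_mul, Finset.mul_sum]
      rw [Finset.sum_comm]
      refine Finset.sum_congr rfl fun w _ => ?_
      refine Fintype.sum_equiv ((MulAut.conj y⁻¹).toEquiv.trans (Equiv.mulLeft w)) _ _ fun g => ?_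
      have hg : (w * (y⁻¹ * g * y))⁻¹ * w = y⁻¹ * g⁻¹ * y⁻¹⁻¹ := by group
      simp only [MulEquiv.toEquiv_eq_coe, Equiv.trans_apply, EquivLike.coe_coe,
        MulAut.conj_apply, Equiv.coe_mulLeft, inv_inv y]
      rw [hg, char_conj, mul_assoc]
    simp only [hc, hΦ, Finset.sum_mul]
    rw [Finset.sum_comm]
    simp only [← Finset.sum_mul, hy]
    simp
  have hnorm : ∀ ρ, ‖c ρ‖ ≤ N ^ 3 / ρ.deg := by
    intro ρ
    have hd0 : (0 : ℝ) < ρ.deg := by exact_mod_cast ρ.deg_pos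
    rw [hcoef, norm_mul, Complex.norm_natCast, le_div_iff₀ hd0]
    have h1 : ‖∑ w, (F w : ℂ) * ∑ u, (H u : ℂ) * ρ.char (u⁻¹ * w)‖
        ≤ ∑ w, ‖∑ u, (H u : ℂ) * ρ.char (u⁻¹ * w)‖ := by
      refine (norm_sum_le _ _).trans (Finset.sum_le_sum fun w _ => ?_)
      rw [norm_mul, Complex.norm_real, Real.norm_eq_abs]
      exact mul_le_of_le_one_left (norm_nonneg _) (hF w)
    have h2 := ρ.deg_mul_sum_norm_conv_char_le H hH
    have h3 := (mul_le_mul_of_nonneg_left h1 hd0.le).trans h2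
    calc _ = N * (ρ.deg * ‖∑ w, (F w : ℂ) * ∑ u, (H u : ℂ) * ρ.char (u⁻¹ * w)‖) := by ring
      _ ≤ N * N ^ 2 := mul_le_mul_of_nonneg_left h3 hN0.le
      _ = N ^ 3 := by ring
  have htriv : c (trivial G) = Fintype.card G * ((∑ w, (F w : ℂ)) * ∑ w, (H w : ℂ)) := by
    rw [hcoef]
    simp [char_trivial, Finset.sum_mul]
  have hexp := card_mul_eq_sum_char Φ hclass t
  rw [← Finset.sum_filter_add_sum_filter_not Finset.univ (fun ρ => ρ ≠ trivial G)] at hexp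
  simp only [not_not, Finset.filter_eq', Finset.mem_univ, if_true, Finset.sum_singleton,
    char_trivial, mul_one] at hexp
  have hdiff : (Fintype.card G : ℂ) * (Φ t - (∑ w, (F w : ℂ)) * ∑ w, (H w : ℂ))
      = ∑ ρ : UnitaryDual G with ρ ≠ trivial G, c ρ * ρ.char t := by
    rw [mul_sub, hexp, ← htriv]
    simp [hc, char_trivial]
  have hreal : Φ t - (∑ w, (F w : ℂ)) * ∑ w, (H w : ℂ)
      = ((∑ y, ∑ w, F w * H (w * (y⁻¹ * t * y)) - (∑ w, F w) * ∑ w, H w : ℝ) : ℂ) := by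
    simp [hΦ]
  have hle := congrArg norm hdiff
  rw [hreal, norm_mul, Complex.norm_natCast, Complex.norm_real, Real.norm_eq_abs] at hle
  refine le_of_mul_le_mul_left ?_ hN0
  rw [hle, ← mul_assoc, ← pow_succ', Finset.mul_sum]
  refine (norm_sum_le _ _).trans (Finset.sum_le_sum fun ρ _ => ?_)
  rw [norm_mul, mul_div_assoc', mul_div_right_comm]
  exact mul_le_mul_of_nonneg_right (hnorm ρ) (norm_nonneg _)

theorem sum_sum_norm_char_div_deg_le [DecidableEq (UnitaryDual G)] :
    ∑ t : G, ∑ ρ : UnitaryDual G with ρ ≠ trivial G, ‖ρ.char t‖ / ρ.deg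
      ≤ Fintype.card G * sumInvDeg G := by
  rw [Finset.sum_comm, sumInvDeg, Finset.mul_sum]
  refine le_of_eq_of_le ?_ (Finset.sum_le_sum (f := fun ρ : UnitaryDual G =>
    (∑ t : G, ‖ρ.char t‖) / ρ.deg) fun ρ _ => ?_)
  · simp only [Finset.sum_div]
    congr!
  · rw [mul_one_div]
    exact div_le_div_of_nonneg_right ρ.sum_norm_char_le (Nat.cast_nonneg _)

end UnitaryDual

/-! ### Cauchy–Schwarz and the progression form -/

section Progressions

variable {G : Type u} [Group G] [Fintype G]

theorem sumInvDeg_nonneg : 0 ≤ sumInvDeg G :=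
  Finset.sum_nonneg fun _ _ => by positivity

theorem abs_mul_le_one {a b : ℝ} (ha : |a| ≤ 1) (hb : |b| ≤ 1) : |a * b| ≤ 1 := by
  rw [abs_mul]
  exact mul_le_one₀ ha (abs_nonneg b) hb

/-- The square sum obtained from the progression form by two applications of the Cauchy–Schwarz
inequality is a sum of correlations averaged over conjugacy classes. -/
theorem sum_sq_sum_eq_sum_conj_correlation (f : G → ℝ) :
    ∑ w, ∑ k, (∑ y, f (w * (y * y)) * f (w * (y * k * y))) ^ 2
      = ∑ h, ∑ z, ∑ y, ∑ v, (f v * f (v * h)) *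
          (fun u => f (u * z) * f (u * (h * z))) (v * (y⁻¹ * z * y)) := by
  -- The new variables are `h = y⁻¹ky` and `z = y⁻¹y'`; later `v = w y²`.
  have hsub : ∀ w y : G, ∑ k, ∑ y', (f (w * (y * y)) * f (w * (y * k * y))) *
        (f (w * (y' * y')) * f (w * (y' * k * y')))
      = ∑ h, ∑ z, (f (w * (y * y)) * f (w * (y * y) * h)) *
        (f (w * (y * y) * (y⁻¹ * z * y) * z) * f (w * (y * y) * (y⁻¹ * z * y) * (h * z))) := by
    intro w y
    refine Fintype.sum_equiv (MulAut.conj y⁻¹).toEquiv _ _ fun k => ?_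
    refine Fintype.sum_equiv (Equiv.mulLeft y⁻¹) _ _ fun y' => ?_
    simp only [MulEquiv.toEquiv_eq_coe, EquivLike.coe_coe, MulAut.conj_apply, Equiv.coe_mulLeft]
    congr 2
    · congr 1; group
    · congr 1; group
    · congr 1; group
  calc ∑ w, ∑ k, (∑ y, f (w * (y * y)) * f (w * (y * k * y))) ^ 2
      = ∑ y, ∑ w, ∑ k, ∑ y', (f (w * (y * y)) * f (w * (y * k * y))) *
        (f (w * (y' * y')) * f (w * (y' * k * y'))) := by
        simp only [sq, Finset.sum_mul_sum]
        refine (Finset.sum_congr rfl fun w _ => Finset.sum_comm).trans ?_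
        exact Finset.sum_comm
    _ = ∑ y, ∑ v, ∑ h, ∑ z, (f v * f (v * h)) *
          (f (v * (y⁻¹ * z * y) * z) * f (v * (y⁻¹ * z * y) * (h * z))) := by
        refine Finset.sum_congr rfl fun y _ => ?_
        simp only [hsub]
        exact Fintype.sum_equiv (Equiv.mulRight (y * y)) _ _ fun w => rfl
    _ = _ := by
        refine (Finset.sum_congr rfl fun y _ => Finset.sum_comm).trans ?_
        rw [Finset.sum_comm]
        refine Finset.sum_congr rfl fun h _ => ?_
        refine (Finset.sum_congr rfl fun y _ => Finset.sum_comm).trans ?_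
        exact Finset.sum_comm

/-- The factor 2 counts two errors of size `N⁴ S`: one from separating `F` and `H`, one from the
remaining products. -/
theorem sum_sq_sum_le (f : G → ℝ) (hf : ∀ x, |f x| ≤ 1) (h0 : ∑ x, f x = 0) :
    ∑ w, ∑ k, (∑ y, f (w * (y * y)) * f (w * (y * k * y))) ^ 2
      ≤ 2 * (Fintype.card G : ℝ) ^ 4 * sumInvDeg G := by
  classical
  rw [sum_sq_sum_eq_sum_conj_correlation]
  set N : ℝ := (Fintype.card G : ℝ) with hN
  have hN0 : 0 ≤ N := Nat.cast_nonneg _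
  set X : G → ℝ := fun t =>
    ∑ ρ : UnitaryDual G with ρ ≠ UnitaryDual.trivial G, ‖ρ.char t‖ / ρ.deg
  have hX : ∑ t, X t ≤ N * sumInvDeg G := UnitaryDual.sum_sum_norm_char_div_deg_le
  set F : G → G → ℝ := fun h v => f v * f (v * h)
  have hF : ∀ h v, |F h v| ≤ 1 := fun h v => abs_mul_le_one (hf _) (hf _)
  set H : G → G → G → ℝ := fun h z u => f (u * z) * f (u * (h * z)) with hHdef
  have hH : ∀ h z u, |H h z u| ≤ 1 := fun h z u => abs_mul_le_one (hf _) (hf _)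
  have hmain : ∀ h z, ∑ y, ∑ v, F h v * H h z (v * (y⁻¹ * z * y))
      ≤ (∑ v, F h v) * ∑ u, H h z u + N ^ 2 * X z := fun h z => by
    linarith [(abs_le.1 (UnitaryDual.abs_sum_conj_correlation_sub_le (F h) (H h z)
      (hF h) (hH h z) z)).2]
  -- Summed over `z`, this is again a correlation averaged over conjugates, now of `h`, whose main
  -- term `(∑ f)²` vanishes.
  have hsumH : ∀ h, |∑ z, ∑ u, H h z u| ≤ N ^ 2 * X h := fun h => by
    have h1 := UnitaryDual.abs_sum_conj_correlation_sub_le f f hf hf h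
    rw [h0, zero_mul, sub_zero] at h1
    have heq : ∑ z, ∑ u, H h z u = ∑ z, ∑ u, f u * f (u * (z⁻¹ * h * z)) := by
      refine Finset.sum_congr rfl fun z _ => ?_
      refine Fintype.sum_equiv (Equiv.mulRight z) _ _ fun u => ?_
      simp [hHdef, mul_assoc]
    rwa [heq]
  have hsumF : ∀ h, |∑ v, F h v| ≤ N := fun h => by
    refine (Finset.abs_sum_le_sum_abs _ _).trans ((Finset.sum_le_sum fun v _ => hF h v).trans ?_)
    simp [hN]
  have hterm : ∀ h, ∑ z, ∑ y, ∑ v, F h v * H h z (v * (y⁻¹ * z * y))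
      ≤ N ^ 3 * X h + N ^ 2 * (N * sumInvDeg G) := fun h => by
    refine (Finset.sum_le_sum fun z _ => hmain h z).trans ?_
    rw [Finset.sum_add_distrib, ← Finset.mul_sum, ← Finset.mul_sum]
    refine add_le_add ((le_abs_self _).trans ?_) (mul_le_mul_of_nonneg_left hX (by positivity))
    rw [abs_mul]
    refine (mul_le_mul (hsumF h) (hsumH h) (abs_nonneg _) hN0).trans (le_of_eq ?_)
    ring
  refine (Finset.sum_le_sum fun h _ => hterm h).trans ?_
  rw [Finset.sum_add_distrib, ← Finset.mul_sum, Finset.sum_const, Finset.card_univ, nsmul_eq_mul,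
    ← hN]
  have := mul_le_mul_of_nonneg_left hX (pow_nonneg hN0 3)
  linarith

/-- The fourth power of the form counting progressions is controlled by `∑ 1 / d_ρ`. -/
theorem sum_progression_pow_four_le (f₁ f₂ f₃ : G → ℝ) (h₁ : ∀ x, |f₁ x| ≤ 1)
    (h₂ : ∀ x, |f₂ x| ≤ 1) (h₃ : ∀ x, |f₃ x| ≤ 1) (h0 : ∑ x, f₃ x = 0) :
    (∑ x, ∑ y, f₁ x * f₂ (x * y) * f₃ (x * y ^ 2)) ^ 4
      ≤ 2 * (Fintype.card G : ℝ) ^ 8 * sumInvDeg G := by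
  set N : ℝ := (Fintype.card G : ℝ) with hN
  have hN0 : 0 ≤ N := Nat.cast_nonneg _
  have sq_le_one : ∀ {a : ℝ}, |a| ≤ 1 → a ^ 2 ≤ 1 := fun ha => (sq_le_one_iff_abs_le_one _).2 ha
  set L := ∑ x, ∑ y, f₁ x * f₂ (x * y) * f₃ (x * y ^ 2)
  set M := ∑ z, (∑ y, f₁ (z * y⁻¹) * f₃ (z * y)) ^ 2
  -- Centring the progression at `z = xy` isolates `f₂` for the first Cauchy–Schwarz.
  have hL : L = ∑ z, f₂ z * ∑ y, f₁ (z * y⁻¹) * f₃ (z * y) := by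
    simp only [Finset.mul_sum]
    refine Finset.sum_comm.trans (Eq.trans ?_ Finset.sum_comm)
    refine Finset.sum_congr rfl fun y _ => ?_
    refine Fintype.sum_equiv (Equiv.mulRight y) _ _ fun x => ?_
    rw [Equiv.coe_mulRight, mul_inv_cancel_right, sq, mul_assoc x y y]
    ring
  have hLM : L ^ 2 ≤ N * M := by
    rw [hL]
    refine (Finset.sum_mul_sq_le_sq_mul_sq _ _ _).trans ?_
    refine mul_le_mul_of_nonneg_right ?_ (Finset.sum_nonneg fun _ _ => sq_nonneg _)
    refine (Finset.sum_le_sum fun z _ => sq_le_one (h₂ z)).trans ?_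
    simp [hN]
  -- With `w = zy⁻¹` and `k = y'y⁻¹`, the factors from `f₁` no longer depend on `y`, ready for the
  -- second Cauchy–Schwarz.
  have hM : M = ∑ p : G × G, (f₁ p.1 * f₁ (p.1 * p.2⁻¹)) *
      ∑ y, f₃ (p.1 * (y * y)) * f₃ (p.1 * (y * p.2 * y)) := by
    rw [Fintype.sum_prod_type]
    calc M = ∑ y, ∑ z, ∑ y', (f₁ (z * y⁻¹) * f₃ (z * y)) * (f₁ (z * y'⁻¹) * f₃ (z * y')) := by
          simp only [M, sq, Finset.sum_mul_sum]
          exact Finset.sum_comm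
      _ = ∑ y, ∑ w, ∑ k, (f₁ w * f₁ (w * k⁻¹)) *
            (f₃ (w * (y * y)) * f₃ (w * (y * k * y))) := by
          refine Finset.sum_congr rfl fun y _ => ?_
          refine Fintype.sum_equiv (Equiv.mulRight y⁻¹) _ _ fun z => ?_
          refine Fintype.sum_equiv (Equiv.mulRight y⁻¹) _ _ fun y' => ?_
          have e1 : z * y⁻¹ * (y' * y⁻¹)⁻¹ = z * y'⁻¹ := by group
          have e2 : z * y⁻¹ * (y * y) = z * y := by group
          have e3 : z * y⁻¹ * (y * (y' * y⁻¹) * y) = z * y' := by group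
          simp only [Equiv.coe_mulRight, e1, e2, e3]
          ring
      _ = _ := by
          simp only [Finset.mul_sum]
          rw [Finset.sum_comm]
          exact Finset.sum_congr rfl fun w _ => Finset.sum_comm
  have hMP : M ^ 2 ≤ N ^ 2 * (2 * N ^ 4 * sumInvDeg G) := by
    rw [hM]
    refine (Finset.sum_mul_sq_le_sq_mul_sq _ _ _).trans ?_
    refine mul_le_mul ?_ ?_ (Finset.sum_nonneg fun _ _ => sq_nonneg _) (by positivity)
    · refine (Finset.sum_le_sum fun p _ => sq_le_one (abs_mul_le_one (h₁ _) (h₁ _))).trans ?_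
      simp [hN, sq]
    · rw [Fintype.sum_prod_type]
      exact sum_sq_sum_le f₃ h₃ h0
  calc L ^ 4 = (L ^ 2) ^ 2 := by ring
    _ ≤ (N * M) ^ 2 := pow_le_pow_left₀ (sq_nonneg _) hLM 2
    _ = N ^ 2 * M ^ 2 := by ring
    _ ≤ N ^ 2 * (N ^ 2 * (2 * N ^ 4 * sumInvDeg G)) := by gcongr
    _ = 2 * N ^ 8 * sumInvDeg G := by ring

theorem progressionForm_eq (f₁ f₂ f₃ : G → ℝ) :
    progressionForm f₁ f₂ f₃
      = (∑ x, ∑ y, f₁ x * f₂ (x * y) * f₃ (x * y ^ 2)) / (Fintype.card G : ℝ) ^ 2 := by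
  simp only [progressionForm, groupMean, ← Finset.sum_div, sq, div_div]

theorem abs_progressionForm_le_one (f₁ f₂ f₃ : G → ℝ) (h₁ : ∀ x, |f₁ x| ≤ 1)
    (h₂ : ∀ x, |f₂ x| ≤ 1) (h₃ : ∀ x, |f₃ x| ≤ 1) : |progressionForm f₁ f₂ f₃| ≤ 1 := by
  rw [progressionForm_eq, abs_div, abs_of_nonneg (by positivity : 0 ≤ (Fintype.card G : ℝ) ^ 2),
    div_le_one (by simp [Fintype.card_pos])]
  calc |∑ x, ∑ y, f₁ x * f₂ (x * y) * f₃ (x * y ^ 2)|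
      ≤ ∑ x : G, ∑ y : G, (1 : ℝ) :=
        (Finset.abs_sum_le_sum_abs _ _).trans <| Finset.sum_le_sum fun x _ =>
          (Finset.abs_sum_le_sum_abs _ _).trans <| Finset.sum_le_sum fun y _ =>
            abs_mul_le_one (abs_mul_le_one (h₁ _) (h₂ _)) (h₃ _)
    _ = (Fintype.card G : ℝ) ^ 2 := by simp [sq]

/-- For `S ≥ 1` the trivial bound suffices. Otherwise the fourth-power estimate gives `(2S)^{1/4}`,
which is stronger than needed. -/
theorem abs_progressionForm_le (f₁ f₂ f₃ : G → ℝ) (h₁ : ∀ x, |f₁ x| ≤ 1)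
    (h₂ : ∀ x, |f₂ x| ≤ 1) (h₃ : ∀ x, |f₃ x| ≤ 1) (h0 : groupMean f₃ = 0) :
    |progressionForm f₁ f₂ f₃| ≤ 2 * sumInvDeg G ^ (1 / 8 : ℝ) := by
  have hS : 0 ≤ sumInvDeg G := sumInvDeg_nonneg
  have hN : (0 : ℝ) < Fintype.card G := by simp [Fintype.card_pos]
  rcases le_total 1 (sumInvDeg G) with h | h
  · linarith [abs_progressionForm_le_one f₁ f₂ f₃ h₁ h₂ h₃,
      Real.one_le_rpow h (by norm_num : (0 : ℝ) ≤ 1 / 8)]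
  have hsum : ∑ x, f₃ x = 0 := by
    simpa [groupMean, hN.ne'] using h0
  have h4 : progressionForm f₁ f₂ f₃ ^ 4 ≤ 2 * sumInvDeg G := by
    rw [progressionForm_eq, div_pow, div_le_iff₀ (by positivity)]
    refine (sum_progression_pow_four_le f₁ f₂ f₃ h₁ h₂ h₃ hsum).trans (le_of_eq ?_)
    ring
  have hr : sumInvDeg G ≤ (sumInvDeg G ^ (1 / 8 : ℝ)) ^ 4 := by
    rw [← Real.rpow_natCast, ← Real.rpow_mul hS]
    conv_lhs => rw [← Real.rpow_one (sumInvDeg G)]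
    exact Real.rpow_le_rpow_of_exponent_ge' hS h (by norm_num) (by norm_num)
  refine le_of_pow_le_pow_left₀ (n := 4) (by norm_num) (by positivity) ?_
  rw [pow_abs, abs_of_nonneg (by positivity), mul_pow]
  nlinarith

theorem progressionCount_eq_sum [DecidableEq G] (A B C : Finset G) :
    (progressionCount A B C : ℝ) = ∑ x, ∑ y, (if x ∈ A then 1 else 0) *
      (if x * y ∈ B then 1 else 0) * (if x * y ^ 2 ∈ C then (1 : ℝ) else 0) := by
  have himg : {p : G × G × G | p.1 ∈ A ∧ p.2.1 ∈ B ∧ p.2.2 ∈ C ∧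
        ∃ x y : G, p = (x, x * y, x * y ^ 2)}
      = (fun q : G × G => (q.1, q.1 * q.2, q.1 * q.2 ^ 2)) ''
        ({q : G × G | q.1 ∈ A ∧ q.1 * q.2 ∈ B ∧ q.1 * q.2 ^ 2 ∈ C} : Finset (G × G)) := by
    ext p
    constructor
    · rintro ⟨ha, hb, hc, x, y, rfl⟩
      exact ⟨(x, y), by simpa using ⟨ha, hb, hc⟩, rfl⟩
    · rintro ⟨q, hq, rfl⟩
      obtain ⟨ha, hb, hc⟩ : q.1 ∈ A ∧ q.1 * q.2 ∈ B ∧ q.1 * q.2 ^ 2 ∈ C := by simpa using hq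
      exact ⟨ha, hb, hc, q.1, q.2, rfl⟩
  -- The first two terms already determine `x` and `y`, so counting triples is counting pairs.
  have hinj : Function.Injective fun q : G × G => (q.1, q.1 * q.2, q.1 * q.2 ^ 2) := by
    rintro ⟨x, y⟩ ⟨x', y'⟩ h
    simp only [Prod.mk.injEq] at h
    obtain ⟨rfl, h, -⟩ := h
    rw [mul_left_cancel h]
  rw [progressionCount, himg, Set.ncard_image_of_injective _ hinj, Set.ncard_coe_finset,
    Finset.card_filter, Fintype.sum_prod_type]
  push_cast
  refine Finset.sum_congr rfl fun x _ => Finset.sum_congr rfl fun y _ => ?_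
  by_cases ha : x ∈ A <;> by_cases hb : x * y ∈ B <;> by_cases hc : x * y ^ 2 ∈ C <;>
    simp [ha, hb, hc]

theorem abs_progressionCount_sub_le (A B C : Finset G) :
    |(progressionCount A B C : ℝ)
        - (A.card : ℝ) * (B.card : ℝ) * (C.card : ℝ) / (Fintype.card G : ℝ)|
      ≤ 2 * (sumInvDeg G ^ (1 / 8 : ℝ) * (Fintype.card G : ℝ) ^ 2) := by
  classical
  have hN : (0 : ℝ) < Fintype.card G := by simp [Fintype.card_pos]
  set a : G → ℝ := fun x => if x ∈ A then 1 else 0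
  set b : G → ℝ := fun x => if x ∈ B then 1 else 0
  -- Subtracting the density of `C` gives mean zero; the subtracted constant produces exactly the
  -- main term `|A||B||C|/|G|`.
  set c : G → ℝ := fun x => (if x ∈ C then 1 else 0) - C.card / Fintype.card G
  have hC : (C.card : ℝ) ≤ Fintype.card G := by exact_mod_cast C.card_le_univ
  have ha : ∀ x, |a x| ≤ 1 := fun x => by simp only [a]; split_ifs <;> simp
  have hb : ∀ x, |b x| ≤ 1 := fun x => by simp only [b]; split_ifs <;> simp
  have hc : ∀ x, |c x| ≤ 1 := fun x => by
    have h1 : (C.card : ℝ) / Fintype.card G ≤ 1 := (div_le_one hN).2 hC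
    have h2 : 0 ≤ (C.card : ℝ) / Fintype.card G := by positivity
    simp only [c]
    split_ifs <;> rw [abs_le] <;> constructor <;> linarith
  have hc0 : groupMean c = 0 := by
    simp [groupMean, c, Finset.sum_sub_distrib, mul_div_cancel₀ _ hN.ne']
  have h := abs_progressionForm_le a b c ha hb hc hc0
  have hab : ∑ x, ∑ y, a x * b (x * y) = A.card * B.card := by
    have : ∀ x, ∑ y, a x * b (x * y) = a x * B.card := fun x => by
      rw [← Finset.mul_sum, show ∑ y, b (x * y) = ∑ y, b y from
        Equiv.sum_comp (Equiv.mulLeft x) b]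
      simp [b]
    simp only [this, ← Finset.sum_mul]
    simp [a]
  have heq : (progressionCount A B C : ℝ)
        - (A.card : ℝ) * (B.card : ℝ) * (C.card : ℝ) / (Fintype.card G : ℝ)
      = progressionForm a b c * (Fintype.card G : ℝ) ^ 2 := by
    rw [progressionForm_eq, div_mul_cancel₀ _ (by positivity), progressionCount_eq_sum,
      mul_div_assoc, ← hab]
    simp only [c, mul_sub, Finset.sum_sub_distrib, Finset.sum_mul]
    rfl
  rw [heq, abs_mul, abs_of_nonneg (by positivity : 0 ≤ (Fintype.card G : ℝ) ^ 2), ← mul_assoc]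
  exact mul_le_mul_of_nonneg_right h (by positivity)

end Progressions

theorem theorem1 :
    ∃ K : ℝ, 0 < K ∧ ∀ (G : Type u) [Group G] [Fintype G],
      (∀ A B C : Finset G,
        |(progressionCount A B C : ℝ)
            - (A.card : ℝ) * (B.card : ℝ) * (C.card : ℝ) / (Fintype.card G : ℝ)|
          ≤ K * (sumInvDeg G ^ (1 / 8 : ℝ) * (Fintype.card G : ℝ) ^ 2)) ∧
      (∀ f₁ f₂ f₃ : G → ℝ,
        (∀ x, |f₁ x| ≤ 1) → (∀ x, |f₂ x| ≤ 1) → (∀ x, |f₃ x| ≤ 1) → groupMean f₃ = 0 →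
          |progressionForm f₁ f₂ f₃| ≤ K * sumInvDeg G ^ (1 / 8 : ℝ)) :=
  ⟨2, two_pos, fun _ _ _ => ⟨abs_progressionCount_sub_le, abs_progressionForm_le⟩⟩
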